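/- Let $M\ge 0$ be an integer, let $\rho,a\in[0,1]$ and $c>0$, and let $f^1,f^2$ be probability densities on $\mathbb R^M$. For $p\in[0,1]$ let $\mathbb P_p$ (with expectation $\mathbb E_p$) be the probability measure on sequences $(X_0,X_1,\dots;\,y_1,y_2,\dots)$ under which $X_k\in\{e_1,e_2\}$ is a time-homogeneous Markov chain with $\mathbb P_p(X_0=e_2)=p$, $\mathbb P_p(X_{k+1}=e_2\mid X_k=e_1)=\rho$ and $\mathbb P_p(X_{k+1}=e_2\mid X_k=e_2)=a$, and, conditionally on $(X_k)_{k\ge 0}$, the measurements $y_k$ ($k\ge1$) are independent, $y_k$ having density $f^i$ if $X_k=e_i$. Put $\hat X^i_k=\mathbb P_p(X_k=e_i\mid y_1,\dots,y_k)$. A stopping rule is an almost surely finite stopping time $\tau\ge 0$ of the filtration $\sigma(y_1,\dots,y_k)$, $k\ge0$; its intermittent signal detection (ISD) cost is $$J_p(\tau)=\mathbb E_p\Big[c\sum_{\ell=0}^{\tau-1}\hat X^2_\ell+\hat X^1_\tau\Big],$$ and the value function is $V(p)=\inf_\tau J_p(\tau)$, the infimum being over all stopping rules. For a belief $p$ and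 a measurement $y$ let $\Phi(p,y)$ be the second component of $\langle \underline 1,B(y)A\hat X\rangle^{-1}B(y)A\hat X$, where $$\hat X=\begin{pmatrix}1-p\\p\end{pmatrix},\qquad A=\begin{pmatrix}1-\rho&1-a\\ \rho&a\end{pmatrix},\qquad B(y)=\operatorname{diag}(f^1(y),f^2(y)).$$ Then $V$ is concave on $[0,1]$ and satisfies the Bellman recursion $$V(p)=\min\big\{c\,p+\mathbb E_p[V(\Phi(p,y_1))],\;1-p\big\}\qquad(0\le p\le 1),$$ where the random variable $V(\Phi(p,y_1))$ is integrable. Moreover there is a threshold $h_s\in[0,1]$, which does not depend on the initial distribution, such that the stopping set $\{p\in[0,1]:V(p)=1-p\}$ is the interval $[h_s,1]$ and such that, for every $p\in[0,1]$, $$\tau^*=\inf\{k\ge 0:\hat X^2_k\ge h_s\}$$ is a stopping rule with $J_p(\tau^*)\le J_p(\tau)$ for every stopping rule $\tau$. If $\rho>0$, this inequality holds also for all stopping times $\tau$ that are not almost surely finite, where on $\{\tau=\infty\}$ the sum runs over all $\ell\ge 0$ and the term $\hat X^1_\tau$ is omitted. -/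

import Mathlib

open MeasureTheory ProbabilityTheory
open scoped ENNReal

noncomputable section

namespace ISD

/-- The space `ℝ^M` in which the measurements take their values. -/
abbrev Obs (M : ℕ) : Type := EuclideanSpace ℝ (Fin M)

/-- The data of the problem. The two states `e₁` (normal) and `e₂` (anomalous) are represented by
the elements `0` and `1` of `Fin 2`. -/
structure Model (M : ℕ) where
  /-- the probability of a transition from `e₁` to `e₂` -/
  rho : ℝ
  /-- the probability of self transition for `e₂` -/
  a : ℝ
  /-- the penalty for each time step spent in `e₂` before the alert -/
  c : ℝ
  /-- `f 0` and `f 1` are the densities of a measurement in state `e₁` and `e₂` -/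
  f : Fin 2 → Obs M → ℝ
  rho_mem : rho ∈ Set.Icc (0 : ℝ) 1
  a_mem : a ∈ Set.Icc (0 : ℝ) 1
  c_pos : 0 < c
  measurable_f : ∀ i, Measurable (f i)
  f_nonneg : ∀ i y, 0 ≤ f i y
  lintegral_f : ∀ i, ∫⁻ y, ENNReal.ofReal (f i y) = 1

/-- The sample space: `(ω k).1` is the state at time `k ≥ 0` and `(ω k).2` is the measurement at
time `k ≥ 1`. There is no measurement at time `0`; the component `(ω 0).2` is a placeholder,
which is `0` almost surely and which is not part of the observations. -/
abbrev Path (M : ℕ) : Type := ℕ → Fin 2 × Obs M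

/-- The state at time `k`. -/
def signal {M : ℕ} (k : ℕ) (ω : Path M) : Fin 2 := (ω k).1

/-- The measurement `y_k` at time `k ≥ 1`. -/
def meas {M : ℕ} (k : ℕ) (ω : Path M) : Obs M := (ω k).2

/-- The `σ`-algebra generated by the measurements `y_1, …, y_k`, for `k ≥ 0`. -/
def obsFiltration (M : ℕ) : Filtration ℕ (inferInstance : MeasurableSpace (Path M)) where
  seq k := ⨆ j ∈ Finset.Icc 1 k, MeasurableSpace.comap (meas j) inferInstance
  mono' k l hkl := by
    refine biSup_mono fun j hj => ?_
    rw [Finset.mem_Icc] at hj ⊢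
    exact ⟨hj.1, hj.2.trans hkl⟩
  le' k := by
    refine iSup₂_le fun j _ => ?_
    exact Measurable.comap_le (measurable_snd.comp (measurable_pi_apply j))

/-- The vector `(1 - p, p)` of the probabilities of `e₁` and `e₂`. -/
def belief (p : ℝ) : Fin 2 → ℝ := ![1 - p, p]

namespace Model

variable {M : ℕ} (m : Model M)

/-- The transition matrix: `m.A i j` is the probability of moving from state `j` to state `i`. -/
def A : Matrix (Fin 2) (Fin 2) ℝ := !![1 - m.rho, 1 - m.a; m.rho, m.a]

/-- The law of a measurement taken in state `i`. -/
def obsLaw (i : Fin 2) : Measure (Obs M) := volume.withDensity fun y => ENNReal.ofReal (m.f i y)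

instance (i : Fin 2) : IsProbabilityMeasure (m.obsLaw i) :=
  ⟨by rw [obsLaw, withDensity_apply _ MeasurableSet.univ, Measure.restrict_univ, m.lintegral_f]⟩

/-- The joint law of the state and of the measurement one step after state `j`. -/
def stepLaw (j : Fin 2) : Measure (Fin 2 × Obs M) :=
  ∑ i, ENNReal.ofReal (m.A i j) • (Measure.dirac i).prod (m.obsLaw i)

instance (j : Fin 2) : IsProbabilityMeasure (m.stepLaw j) := by
  obtain ⟨h1, h2⟩ := m.rho_mem
  obtain ⟨h3, h4⟩ := m.a_mem
  constructor
  fin_cases j <;>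
    simp only [stepLaw, A, Fin.sum_univ_two, Measure.add_apply, Measure.smul_apply, measure_univ,
      smul_eq_mul, mul_one] <;>
    simp <;>
    rw [← ENNReal.ofReal_add (by linarith) (by linarith)] <;> simp

/-- One step of the process as a kernel that depends on the history up to time `n` through the
state at time `n` only. -/
def stepKernel (n : ℕ) : Kernel ((_ : Finset.Iic n) → Fin 2 × Obs M) (Fin 2 × Obs M) :=
  (Kernel.ofFunOfCountable m.stepLaw).comap (fun h => (h ⟨n, by simp⟩).1)
    (measurable_fst.comp (measurable_pi_apply _))

instance (n : ℕ) : IsMarkovKernel (m.stepKernel n) :=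
  ⟨fun h => by
    rw [stepKernel, Kernel.comap_apply]
    exact inferInstanceAs (IsProbabilityMeasure (m.stepLaw _))⟩

/-- The law at time `0` when the initial state is `e₂` with probability `p`. -/
def initLaw (M : ℕ) (p : ℝ) : Measure (Fin 2 × Obs M) :=
  (∑ i, ENNReal.ofReal (belief p i) • Measure.dirac i).prod (Measure.dirac 0)

/-- The probability measure on the sample space under which the states form a Markov chain with
transition matrix `m.A`, started from `e₂` with probability `p`, and the measurements are
conditionally independent given the states, `y_k` having density `f 0` or `f 1` according to the
state at time `k`. -/
def law (p : ℝ) : Measure (Path M) :=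
  Kernel.trajMeasure (X := fun _ => Fin 2 × Obs M) (initLaw M p) m.stepKernel

/-- The conditional mean estimate: the conditional probability, given `y_1, …, y_k`, that the
state at time `k` is `i`. -/
def cme (p : ℝ) (i : Fin 2) (k : ℕ) : Path M → ℝ :=
  (m.law p)[({ω | signal k ω = i} : Set (Path M)).indicator (fun _ => (1 : ℝ)) | obsFiltration M k]

open Classical in
/-- The cost `E[c ∑_{ℓ < τ} X̂²_ℓ + X̂¹_τ]` of a stopping time `τ`. Where `τ` is infinite, the sum
is over all `ℓ` and the last term is absent. -/
def cost (p : ℝ) (τ : Path M → WithTop ℕ) : ℝ≥0∞ :=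
  ∫⁻ ω, (ENNReal.ofReal m.c * ∑' l : ℕ,
      (if (l : WithTop ℕ) < τ ω then ENNReal.ofReal (m.cme p 1 l ω) else 0)
    + (if τ ω = ⊤ then 0 else ENNReal.ofReal (m.cme p 0 (τ ω).untopA ω))) ∂(m.law p)

/-- A stopping rule: a stopping time of the observations which is finite almost surely. -/
def IsStoppingRule (p : ℝ) (τ : Path M → WithTop ℕ) : Prop :=
  IsStoppingTime (obsFiltration M) τ ∧ ∀ᵐ ω ∂(m.law p), τ ω ≠ ⊤

/-- The stopping rule `τ` has the least cost among all stopping rules. -/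
def IsOptimal (p : ℝ) (τ : Path M → WithTop ℕ) : Prop :=
  m.IsStoppingRule p τ ∧ ∀ σ, m.IsStoppingRule p σ → m.cost p τ ≤ m.cost p σ

/-- The first time `k ≥ 0` at which the conditional probability of `e₂` is at least `h`, and `⊤`
if there is no such time. -/
def thresholdRule (p h : ℝ) : Path M → WithTop ℕ := hittingAfter (m.cme p 1) (Set.Ici h) 0

/-- The value function, in terms of the probability `p` of `e₂` at time `0`. -/
def value (p : ℝ) : ℝ := (⨅ τ : {τ // m.IsStoppingRule p τ}, m.cost p τ).toReal

/-- The vector `B(y) A X̂` with `X̂ = (1 - p, p)` and `B(y) = diag(f¹(y), f²(y))`. -/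
def unnormalized (p : ℝ) (y : Obs M) : Fin 2 → ℝ :=
  (Matrix.diagonal (fun i => m.f i y) * m.A).mulVec (belief p)

/-- The probability of `e₂` in the updated belief `⟨1, B(y) A X̂⟩⁻¹ B(y) A X̂`. -/
def update (p : ℝ) (y : Obs M) : ℝ :=
  (∑ i, m.unnormalized p y i)⁻¹ * m.unnormalized p y 1

end Model

end ISD

end

/-! The belief is a sufficient statistic. By Bayes' rule and the Markov property, the recursively
computed `post` equals the conditional probability of `e₂` almost surely (`filterAt`, `cme_ae_eq`),
and given the past the next measurement has law `obsMix` at the current belief. The problem becomes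
optimal stopping of the belief.

Value iteration from `1 - p` decreases to `valueLim`, which solves the Bellman equation by monotone
convergence. Each iterate is concave: the Bayes denominator is affine in the belief, and dividing by
it turns mixtures into mixtures. A concave function below `1 - p` that touches it at `1` stays equal
to it from any contact point onwards, so the stopping set is an interval ending at `1`. It contains
its infimum, by concavity if the infimum is positive and by a direct comparison at `0`.

Verification: the cost paid before time `n` plus the value still outstanding bounds `valueLim` from
above, with equality if the Bellman equation is obeyed. For a finite stopping time the outstanding
value tends to zero (`valueLim_le_cost`); for the threshold rule it is simply dropped
(`cost_le_valueLim`). Finite cost forces finite stopping if `ρ > 0`; if `ρ = 0` the threshold is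
`0`. Hence `value` is `valueLim`. -/

noncomputable section

namespace ISD

/-! ### Observation histories -/

/-- The measurements `y_1, …, y_k`. -/
def obsPast {M : ℕ} (k : ℕ) (ω : Path M) : Fin k → Obs M := fun i => meas (i + 1) ω

lemma measurable_meas {M : ℕ} (k : ℕ) : Measurable (meas k : Path M → Obs M) :=
  measurable_snd.comp (measurable_pi_apply k)

lemma measurable_signal {M : ℕ} (k : ℕ) : Measurable (signal k : Path M → Fin 2) :=
  measurable_fst.comp (measurable_pi_apply k)

lemma measurable_obsPast {M : ℕ} (k : ℕ) : Measurable (obsPast k : Path M → Fin k → Obs M) :=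
  measurable_pi_iff.2 fun _ => measurable_meas _

lemma obsPast_succ {M : ℕ} (k : ℕ) (ω : Path M) :
    obsPast (k + 1) ω = Fin.snoc (α := fun _ => Obs M) (obsPast k ω) (meas (k + 1) ω) := by
  funext i
  refine Fin.lastCases ?_ (fun j => ?_) i
  · simp [obsPast]
  · simp [obsPast]

lemma measurable_snoc {M : ℕ} (k : ℕ) : Measurable fun x : (Fin k → Obs M) × Obs M =>
    Fin.snoc (α := fun _ => Obs M) x.1 x.2 := by
  refine measurable_pi_iff.2 fun i => ?_
  refine Fin.lastCases ?_ (fun j => ?_) i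
  · simpa using measurable_snd
  · simpa using! (measurable_pi_apply j).comp measurable_fst

lemma obsFiltration_eq_comap {M : ℕ} (k : ℕ) :
    obsFiltration M k = MeasurableSpace.comap (obsPast k) inferInstance := by
  change (⨆ j ∈ Finset.Icc 1 k, MeasurableSpace.comap (meas j) inferInstance) = _
  have h : MeasurableSpace.comap (obsPast k) inferInstance
      = ⨆ i : Fin k, MeasurableSpace.comap (meas (M := M) (i + 1)) inferInstance := by
    change MeasurableSpace.comap (obsPast k) (⨆ i : Fin k, _) = _
    simp only [MeasurableSpace.comap_iSup, MeasurableSpace.comap_comp]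
    rfl
  rw [h]
  refine le_antisymm (iSup₂_le fun j hj => ?_) (iSup_le fun i => ?_)
  · rw [Finset.mem_Icc] at hj
    refine le_iSup_of_le ⟨j - 1, by omega⟩ (le_of_eq ?_)
    congr 1
    funext ω
    simp [Nat.sub_add_cancel hj.1]
  · exact le_iSup₂_of_le (i.1 + 1) (Finset.mem_Icc.2 ⟨by omega, by omega⟩) le_rfl

lemma measurable_belief (i : Fin 2) : Measurable fun p => belief p i := by
  fin_cases i
  · exact measurable_const.sub measurable_id
  · exact measurable_id

lemma belief_nonneg {p : ℝ} (hp : p ∈ Set.Icc (0 : ℝ) 1) (i : Fin 2) : 0 ≤ belief p i := by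
  fin_cases i
  · simpa [belief] using hp.2
  · exact hp.1

lemma sum_ofReal_belief {p : ℝ} (hp : p ∈ Set.Icc (0 : ℝ) 1) :
    ∑ i, ENNReal.ofReal (belief p i) = 1 := by
  rw [← ENNReal.ofReal_sum_of_nonneg fun i _ => belief_nonneg hp i]
  simp [belief]

namespace Model

variable {M : ℕ} (m : Model M)

lemma isProbabilityMeasure_initLaw {M : ℕ} {p : ℝ} (hp : p ∈ Set.Icc (0 : ℝ) 1) :
    IsProbabilityMeasure (initLaw M p) := by
  have : IsProbabilityMeasure
      (∑ i, ENNReal.ofReal (belief p i) • Measure.dirac i : Measure (Fin 2)) :=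
    ⟨by simpa [Measure.finsetSum_apply] using sum_ofReal_belief hp⟩
  rw [initLaw]
  infer_instance

/-! ### Prediction and Bayes' rule -/

/-- The predicted probabilities of the two states one step ahead. -/
def predict (p : ℝ) : Fin 2 → ℝ := m.A.mulVec (belief p)

/-- The law of the next measurement, given the belief `p`. -/
def obsMix (p : ℝ) : Measure (Obs M) := ∑ i, ENNReal.ofReal (m.predict p i) • m.obsLaw i

/-- The probability of `e₂` after the measurements `v`, computed recursively. -/
def filtered (p : ℝ) : (k : ℕ) → (Fin k → Obs M) → ℝ
  | 0, _ => p
  | k + 1, v => m.update (filtered p k (Fin.init v)) (v (Fin.last k))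

/-- The recursively computed belief at time `k`. -/
def post (p : ℝ) (k : ℕ) (ω : Path M) : ℝ := m.filtered p k (obsPast k ω)

lemma post_zero (p : ℝ) (ω : Path M) : m.post p 0 ω = p := rfl

lemma filtered_snoc (p : ℝ) (k : ℕ) (v : Fin k → Obs M) (y : Obs M) :
    m.filtered p (k + 1) (Fin.snoc (α := fun _ => Obs M) v y) = m.update (m.filtered p k v) y := by
  simp [filtered]

lemma post_succ (p : ℝ) (k : ℕ) (ω : Path M) :
    m.post p (k + 1) ω = m.update (m.post p k ω) (meas (k + 1) ω) := by
  rw [post, obsPast_succ, filtered_snoc, post]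

lemma A_nonneg (i j : Fin 2) : 0 ≤ m.A i j := by
  obtain ⟨h1, h2⟩ := m.rho_mem
  obtain ⟨h3, h4⟩ := m.a_mem
  fin_cases i <;> fin_cases j <;> simp [A] <;> linarith

lemma predict_zero (p : ℝ) : m.predict p 0 = (1 - m.rho) * (1 - p) + (1 - m.a) * p := by
  simp [predict, A, belief, Matrix.mulVec, dotProduct]

lemma predict_one (p : ℝ) : m.predict p 1 = m.rho * (1 - p) + m.a * p := by
  simp [predict, A, belief, Matrix.mulVec, dotProduct]

lemma predict_add (s t p q : ℝ) (hst : s + t = 1) (i : Fin 2) :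
    m.predict (s * p + t * q) i = s * m.predict p i + t * m.predict q i := by
  obtain rfl : s = 1 - t := by linarith
  fin_cases i
  · simp only [Fin.zero_eta, predict_zero]; ring
  · simp only [Fin.mk_one, predict_one]; ring

lemma predict_nonneg {p : ℝ} (hp : p ∈ Set.Icc (0 : ℝ) 1) (i : Fin 2) : 0 ≤ m.predict p i := by
  simp only [predict, Matrix.mulVec, dotProduct]
  exact Finset.sum_nonneg fun j _ => mul_nonneg (m.A_nonneg i j) (belief_nonneg hp j)

lemma measurable_predict (i : Fin 2) : Measurable fun p => m.predict p i := by
  simp only [predict, Matrix.mulVec, dotProduct]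
  exact Finset.measurable_sum _ fun j _ => (measurable_belief j).const_mul _

lemma sum_predict (p : ℝ) : ∑ i, m.predict p i = 1 := by
  rw [Fin.sum_univ_two, predict_zero, predict_one]; ring

lemma unnormalized_apply (p : ℝ) (y : Obs M) (i : Fin 2) :
    m.unnormalized p y i = m.f i y * m.predict p i := by
  rw [unnormalized, ← Matrix.mulVec_mulVec, Matrix.mulVec_diagonal, predict]

lemma unnormalized_nonneg {p : ℝ} (hp : p ∈ Set.Icc (0 : ℝ) 1) (y : Obs M) (i : Fin 2) :
    0 ≤ m.unnormalized p y i := by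
  rw [unnormalized_apply]
  exact mul_nonneg (m.f_nonneg i y) (m.predict_nonneg hp i)

lemma measurable_unnormalized (i : Fin 2) :
    Measurable fun x : ℝ × Obs M => m.unnormalized x.1 x.2 i := by
  simp only [unnormalized_apply]
  exact ((m.measurable_f i).comp measurable_snd).mul ((m.measurable_predict i).comp measurable_fst)

lemma measurable_update : Measurable fun x : ℝ × Obs M => m.update x.1 x.2 := by
  simp only [update]
  exact (Finset.measurable_sum _ fun i _ => m.measurable_unnormalized i).inv.mul
    (m.measurable_unnormalized 1)

lemma measurable_update_comp {α : Type*} [MeasurableSpace α] {f : α → ℝ} {g : α → Obs M}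
    (hf : Measurable f) (hg : Measurable g) : Measurable fun x => m.update (f x) (g x) := by
  have h := m.measurable_update.comp (hf.prodMk hg)
  exact h

lemma update_mem {p : ℝ} (hp : p ∈ Set.Icc (0 : ℝ) 1) (y : Obs M) :
    m.update p y ∈ Set.Icc (0 : ℝ) 1 := by
  have h0 := m.unnormalized_nonneg hp y 0
  have h1 := m.unnormalized_nonneg hp y 1
  rw [update, Fin.sum_univ_two, inv_mul_eq_div]
  exact ⟨by positivity, div_le_one_of_le₀ (by linarith) (by linarith)⟩

/-- Multiplying out the quotient makes the identity survive a zero denominator: both unnormalized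
weights are nonnegative, so both then vanish. -/
lemma belief_update_mul {p : ℝ} (hp : p ∈ Set.Icc (0 : ℝ) 1) (y : Obs M) (i : Fin 2) :
    belief (m.update p y) i * ∑ j, m.unnormalized p y j = m.unnormalized p y i := by
  have h0 := m.unnormalized_nonneg hp y 0
  have h1 := m.unnormalized_nonneg hp y 1
  rw [update, Fin.sum_univ_two]
  rcases eq_or_ne (m.unnormalized p y 0 + m.unnormalized p y 1) 0 with h | h
  · have e0 : m.unnormalized p y 0 = 0 := by linarith
    have e1 : m.unnormalized p y 1 = 0 := by linarith
    fin_cases i <;> simp [e0, e1]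
  · fin_cases i
    · simp only [belief, Fin.zero_eta, Matrix.cons_val_zero]
      field_simp
      ring
    · simp only [belief, Fin.mk_one, Matrix.cons_val_one, Matrix.cons_val_fin_one]
      field_simp

lemma measurable_filtered (p : ℝ) (k : ℕ) : Measurable (m.filtered p k) := by
  induction k with
  | zero => exact measurable_const
  | succ k ih =>
    have h : Measurable fun v : Fin (k + 1) → Obs M => (Fin.init v : Fin k → Obs M) :=
      measurable_pi_iff.2 fun i => measurable_pi_apply _
    have hl : Measurable fun v : Fin (k + 1) → Obs M => v (Fin.last k) :=
      measurable_pi_apply (Fin.last k)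
    have e : m.filtered p (k + 1)
        = fun v => m.update (m.filtered p k (Fin.init v)) (v (Fin.last k)) := rfl
    rw [e]
    have h' : Measurable fun v : Fin (k + 1) → Obs M => m.filtered p k (Fin.init v) := ih.comp h
    exact m.measurable_update_comp h' hl

lemma measurable_post (p : ℝ) (k : ℕ) : Measurable (m.post p k) :=
  (m.measurable_filtered p k).comp (measurable_obsPast k)

lemma filtered_mem {p : ℝ} (hp : p ∈ Set.Icc (0 : ℝ) 1) (k : ℕ) (v : Fin k → Obs M) :
    m.filtered p k v ∈ Set.Icc (0 : ℝ) 1 := by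
  induction k with
  | zero => exact hp
  | succ k ih => exact m.update_mem (ih _) _

lemma post_mem {p : ℝ} (hp : p ∈ Set.Icc (0 : ℝ) 1) (k : ℕ) (ω : Path M) :
    m.post p k ω ∈ Set.Icc (0 : ℝ) 1 :=
  m.filtered_mem hp k _

lemma lintegral_obsMix (p : ℝ) (g : Obs M → ℝ≥0∞) :
    ∫⁻ y, g y ∂(m.obsMix p) = ∑ i, ENNReal.ofReal (m.predict p i) * ∫⁻ y, g y ∂(m.obsLaw i) := by
  simp [obsMix]

lemma obsMix_eq_withDensity {p : ℝ} (hp : p ∈ Set.Icc (0 : ℝ) 1) :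
    m.obsMix p = volume.withDensity fun y => ENNReal.ofReal (∑ i, m.unnormalized p y i) := by
  have h : (fun y => ENNReal.ofReal (∑ i, m.unnormalized p y i))
      = ENNReal.ofReal (m.predict p 0) • (fun y => ENNReal.ofReal (m.f 0 y))
        + ENNReal.ofReal (m.predict p 1) • (fun y => ENNReal.ofReal (m.f 1 y)) := by
    funext y
    rw [Fin.sum_univ_two, ENNReal.ofReal_add (m.unnormalized_nonneg hp y 0)
      (m.unnormalized_nonneg hp y 1)]
    simp only [unnormalized_apply, Pi.add_apply, Pi.smul_apply, smul_eq_mul]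
    rw [mul_comm (m.f 0 y), mul_comm (m.f 1 y), ENNReal.ofReal_mul (m.predict_nonneg hp 0),
      ENNReal.ofReal_mul (m.predict_nonneg hp 1)]
  have hf := fun i => (m.measurable_f i).ennreal_ofReal
  rw [h, withDensity_add_left ((hf 0).const_smul _), withDensity_smul _ (hf 0),
    withDensity_smul _ (hf 1), obsMix, Fin.sum_univ_two]
  rfl

lemma measurable_ofReal_sum_unnormalized (p : ℝ) :
    Measurable fun y => ENNReal.ofReal (∑ i, m.unnormalized p y i) :=
  (Finset.measurable_sum _ fun i _ =>
    (m.measurable_unnormalized i).comp measurable_prodMk_left).ennreal_ofReal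

lemma isProbabilityMeasure_obsMix {p : ℝ} (hp : p ∈ Set.Icc (0 : ℝ) 1) :
    IsProbabilityMeasure (m.obsMix p) := by
  refine ⟨?_⟩
  have h := m.lintegral_obsMix p 1
  simp only [Pi.one_apply, lintegral_const, measure_univ, mul_one, one_mul] at h
  rw [h, ← ENNReal.ofReal_sum_of_nonneg fun i _ => m.predict_nonneg hp i, sum_predict]
  simp

/-- Bayes' rule: under the law of the next measurement, the updated belief is the likelihood
ratio of the two states. -/
lemma lintegral_mul_belief_update {p : ℝ} (hp : p ∈ Set.Icc (0 : ℝ) 1) {g : Obs M → ℝ≥0∞}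
    (hg : Measurable g) (i : Fin 2) :
    ∫⁻ y, g y * ENNReal.ofReal (belief (m.update p y) i) ∂(m.obsMix p)
      = ENNReal.ofReal (m.predict p i) * ∫⁻ y, g y ∂(m.obsLaw i) := by
  have hb : Measurable fun y => ENNReal.ofReal (belief (m.update p y) i) :=
    ((measurable_belief i).comp (m.measurable_update.comp measurable_prodMk_left)).ennreal_ofReal
  have hf := (m.measurable_f i).ennreal_ofReal
  have e := lintegral_withDensity_eq_lintegral_mul volume
    (m.measurable_ofReal_sum_unnormalized p) (hg.mul hb)
  simp only [Pi.mul_apply] at e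
  rw [m.obsMix_eq_withDensity hp, e, obsLaw,
    lintegral_withDensity_eq_lintegral_mul _ hf hg, ← lintegral_const_mul _ (hf.mul hg)]
  refine lintegral_congr fun y => ?_
  simp only [Pi.mul_apply]
  -- The density of `obsMix` is the Bayes denominator, which cancels the one in `update`.
  have h := m.belief_update_mul hp y i
  have h' : ENNReal.ofReal (belief (m.update p y) i) * ENNReal.ofReal (∑ j, m.unnormalized p y j)
      = ENNReal.ofReal (m.f i y) * ENNReal.ofReal (m.predict p i) := by
    rw [← ENNReal.ofReal_mul (belief_nonneg (m.update_mem hp y) i), h, unnormalized_apply,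
      ENNReal.ofReal_mul (m.f_nonneg i y)]
  calc _ = ENNReal.ofReal (belief (m.update p y) i) * ENNReal.ofReal (∑ j, m.unnormalized p y j)
        * g y := by ring
    _ = _ := by rw [h']; ring

lemma lintegral_belief_update {p : ℝ} (hp : p ∈ Set.Icc (0 : ℝ) 1) (i : Fin 2) :
    ∫⁻ y, ENNReal.ofReal (belief (m.update p y) i) ∂(m.obsMix p)
      = ENNReal.ofReal (m.predict p i) := by
  simpa using m.lintegral_mul_belief_update hp (g := fun _ => 1) measurable_const i

/-! ### The path law and correctness of the filter -/

lemma isProbabilityMeasure_law {p : ℝ} (hp : p ∈ Set.Icc (0 : ℝ) 1) :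
    IsProbabilityMeasure (m.law p) := by
  have := isProbabilityMeasure_initLaw (M := M) hp
  rw [law]
  infer_instance

lemma lintegral_stepLaw (j : Fin 2) {G : Fin 2 × Obs M → ℝ≥0∞} (hG : Measurable G) :
    ∫⁻ z, G z ∂(m.stepLaw j)
      = ∑ i, ENNReal.ofReal (m.A i j) * ∫⁻ y, G (i, y) ∂(m.obsLaw i) := by
  rw [stepLaw, lintegral_finsetSum_measure]
  refine Finset.sum_congr rfl fun i _ => ?_
  rw [lintegral_smul_measure, lintegral_prod _ hG.aemeasurable,
    lintegral_dirac' _ hG.lintegral_prod_right', smul_eq_mul]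

/-- The Markov property of the trajectory. -/
lemma lintegral_obsPast_step {p : ℝ} (hp : p ∈ Set.Icc (0 : ℝ) 1) (k : ℕ)
    {G : (Fin k → Obs M) × (Fin 2 × Obs M) → ℝ≥0∞} (hG : Measurable G) :
    ∫⁻ ω, G (obsPast k ω, ω (k + 1)) ∂(m.law p)
      = ∫⁻ ω, ∫⁻ z, G (obsPast k ω, z) ∂(m.stepLaw (signal k ω)) ∂(m.law p) := by
  have := isProbabilityMeasure_initLaw (M := M) hp
  have := m.isProbabilityMeasure_law hp
  let hist : ((_ : Finset.Iic k) → Fin 2 × Obs M) → Fin k → Obs M :=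
    fun h i => (h ⟨i + 1, Finset.mem_Iic.2 i.2⟩).2
  have hhist : Measurable hist :=
    measurable_pi_iff.2 fun i => measurable_snd.comp (measurable_pi_apply _)
  have hG' : Measurable fun x : ((_ : Finset.Iic k) → Fin 2 × Obs M) × (Fin 2 × Obs M) =>
      G (hist x.1, x.2) :=
    hG.comp ((hhist.comp measurable_fst).prodMk measurable_snd)
  have key := Kernel.map_frestrictLe_trajMeasure_compProd_eq_map_trajMeasure
    (X := fun _ => Fin 2 × Obs M) (μ₀ := initLaw M p) (κ := m.stepKernel) (a := k)
  change (m.law p).map _ ⊗ₘ m.stepKernel k = (m.law p).map _ at key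
  have hr : Measurable (Preorder.frestrictLe (π := fun _ => Fin 2 × Obs M) k) := by fun_prop
  have e1 : ∫⁻ ω, G (obsPast k ω, ω (k + 1)) ∂(m.law p) = ∫⁻ x, G (hist x.1, x.2)
      ∂((m.law p).map fun x => (Preorder.frestrictLe (π := fun _ => Fin 2 × Obs M) k x,
        x (k + 1))) := by
    rw [lintegral_map hG' (by fun_prop)]
    rfl
  rw [e1, ← key, Measure.lintegral_compProd hG', lintegral_map _ hr]
  · rfl
  · exact hG'.lintegral_kernel_prod_right'

lemma lintegral_signal_zero {p : ℝ} (hp : p ∈ Set.Icc (0 : ℝ) 1) (i : Fin 2) :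
    ∫⁻ ω, (if signal 0 ω = i then 1 else 0) ∂(m.law p) = ENNReal.ofReal (belief p i) := by
  have := isProbabilityMeasure_initLaw (M := M) hp
  have h0 : (m.law p).map (fun ω => ω 0) = initLaw M p := by
    have e : (m.law p).map (Preorder.frestrictLe (π := fun _ => Fin 2 × Obs M) 0) =
        (initLaw M p).map (MeasurableEquiv.piUnique _).symm := by
      rw [law, Kernel.trajMeasure, Measure.map_comp _ _ (by fun_prop),
        Kernel.traj_map_frestrictLe, Kernel.partialTraj_self, Measure.id_comp]
    have e' := congrArg (Measure.map fun h => h ⟨0, by simp⟩) e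
    rw [Measure.map_map (by fun_prop) (by fun_prop),
      Measure.map_map (by fun_prop) (by fun_prop)] at e'
    exact e'.trans Measure.map_id
  have hm : Measurable fun z : Fin 2 × Obs M => if z.1 = i then (1 : ℝ≥0∞) else 0 :=
    (measurable_of_countable fun j : Fin 2 => if j = i then (1 : ℝ≥0∞) else 0).comp measurable_fst
  have e := lintegral_map (μ := m.law p) hm (measurable_pi_apply 0)
  rw [h0] at e
  change ∫⁻ ω, (if (ω 0).1 = i then 1 else 0) ∂(m.law p) = _
  rw [← e, initLaw, lintegral_prod _ hm.aemeasurable]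
  fin_cases i <;> simp

/-- The recursively computed belief is the conditional law of the state, in integrated form. -/
def FilterAt (p : ℝ) (k : ℕ) : Prop :=
  ∀ (i : Fin 2) (g : (Fin k → Obs M) → ℝ≥0∞), Measurable g →
    ∫⁻ ω, g (obsPast k ω) * (if signal k ω = i then 1 else 0) ∂(m.law p)
      = ∫⁻ ω, g (obsPast k ω) * ENNReal.ofReal (belief (m.post p k ω) i) ∂(m.law p)

variable {m} in
lemma FilterAt.lintegral_signal {p : ℝ} {k : ℕ} (h : m.FilterAt p k)
    {F : Fin 2 → (Fin k → Obs M) → ℝ≥0∞} (hF : ∀ j, Measurable (F j)) :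
    ∫⁻ ω, F (signal k ω) (obsPast k ω) ∂(m.law p)
      = ∫⁻ ω, ∑ j, ENNReal.ofReal (belief (m.post p k ω) j) * F j (obsPast k ω) ∂(m.law p) := by
  have e : ∀ ω : Path M, F (signal k ω) (obsPast k ω)
      = ∑ j, F j (obsPast k ω) * (if signal k ω = j then 1 else 0) := fun ω => by simp
  have hF' := fun j => (hF j).comp (measurable_obsPast k)
  simp only [e]
  rw [lintegral_finsetSum, lintegral_finsetSum]
  · refine Finset.sum_congr rfl fun j _ => ?_
    rw [h j (F j) (hF j)]
    exact lintegral_congr fun ω => mul_comm _ _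
  · exact fun j _ => (((measurable_belief j).comp (m.measurable_post p k)).ennreal_ofReal).mul
      (hF' j)
  · exact fun j _ => (hF' j).mul ((measurable_of_countable fun l : Fin 2 =>
      if l = j then (1 : ℝ≥0∞) else 0).comp (measurable_signal k))

variable {m} in
-- Conditioning on the past replaces the hidden state by the belief; averaging the columns of `A`
-- over the belief gives `predict`.
lemma FilterAt.lintegral_step {p : ℝ} (hp : p ∈ Set.Icc (0 : ℝ) 1) {k : ℕ} (h : m.FilterAt p k)
    {G : (Fin k → Obs M) × (Fin 2 × Obs M) → ℝ≥0∞} (hG : Measurable G) :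
    ∫⁻ ω, G (obsPast k ω, ω (k + 1)) ∂(m.law p)
      = ∫⁻ ω, ∑ i, ENNReal.ofReal (m.predict (m.post p k ω) i) *
          ∫⁻ y, G (obsPast k ω, i, y) ∂(m.obsLaw i) ∂(m.law p) := by
  have hi : ∀ i : Fin 2, Measurable fun v => ∫⁻ y, G (v, i, y) ∂(m.obsLaw i) := fun i =>
    Measurable.lintegral_prod_right' (f := fun x : (Fin k → Obs M) × Obs M => G (x.1, i, x.2))
      (hG.comp (by fun_prop))
  rw [m.lintegral_obsPast_step hp k hG]
  have e : ∀ ω : Path M, ∫⁻ z, G (obsPast k ω, z) ∂(m.stepLaw (signal k ω))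
      = (fun j v => ∑ i, ENNReal.ofReal (m.A i j) * ∫⁻ y, G (v, i, y) ∂(m.obsLaw i))
        (signal k ω) (obsPast k ω) :=
    fun ω => m.lintegral_stepLaw _ (hG.comp measurable_prodMk_left)
  simp only [e]
  refine (h.lintegral_signal (F := fun j v => ∑ i, ENNReal.ofReal (m.A i j) *
    ∫⁻ y, G (v, i, y) ∂(m.obsLaw i)) fun j =>
      Finset.measurable_sum _ fun i _ => (hi i).const_mul _).trans ?_
  refine lintegral_congr fun ω => ?_
  simp only [Finset.mul_sum, ← mul_assoc]
  rw [Finset.sum_comm]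
  refine Finset.sum_congr rfl fun i _ => ?_
  rw [← Finset.sum_mul, predict, Matrix.mulVec, dotProduct, ENNReal.ofReal_sum_of_nonneg
    fun j _ => mul_nonneg (m.A_nonneg i j) (belief_nonneg (m.post_mem hp k ω) j)]
  congr 1
  refine Finset.sum_congr rfl fun j _ => ?_
  rw [ENNReal.ofReal_mul (m.A_nonneg i j), mul_comm]

lemma measurable_belief_update (i : Fin 2)
    {α : Type*} [MeasurableSpace α] {f : α → ℝ} {g : α → Obs M}
    (hf : Measurable f) (hg : Measurable g) :
    Measurable fun x => ENNReal.ofReal (belief (m.update (f x) (g x)) i) :=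
  ((measurable_belief i).comp (m.measurable_update_comp hf hg)).ennreal_ofReal

/-- Induction on time: `FilterAt.lintegral_step` rewrites both sides as integrals over the next
measurement, and Bayes' rule `lintegral_mul_belief_update` equates the integrands. -/
lemma filterAt {p : ℝ} (hp : p ∈ Set.Icc (0 : ℝ) 1) (k : ℕ) : m.FilterAt p k := by
  induction k with
  | zero =>
    intro i g _
    have hc : ∀ ω : Path M, obsPast 0 ω = Fin.elim0 := fun ω => funext fun i => i.elim0
    have := m.isProbabilityMeasure_law hp
    simp only [hc, post_zero]
    have hs : Measurable fun ω : Path M => if signal 0 ω = i then (1 : ℝ≥0∞) else 0 :=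
      (measurable_of_countable fun l : Fin 2 =>
        if l = i then (1 : ℝ≥0∞) else 0).comp (measurable_signal 0)
    rw [lintegral_const_mul _ hs, m.lintegral_signal_zero hp]
    simp
  | succ k ih =>
    intro i g hg
    have hgs := hg.comp (measurable_snoc (M := M) k)
    have hG1 : Measurable fun x : (Fin k → Obs M) × (Fin 2 × Obs M) =>
        g (Fin.snoc (α := fun _ => Obs M) x.1 x.2.2) * (if x.2.1 = i then (1 : ℝ≥0∞) else 0) :=
      (hgs.comp (measurable_fst.prodMk (measurable_snd.comp measurable_snd))).mul
        ((measurable_of_countable fun l : Fin 2 => if l = i then (1 : ℝ≥0∞) else 0).comp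
          (measurable_fst.comp measurable_snd))
    have hb : Measurable fun x : (Fin k → Obs M) × (Fin 2 × Obs M) =>
        ENNReal.ofReal (belief (m.update (m.filtered p k x.1) x.2.2) i) :=
      m.measurable_belief_update i ((m.measurable_filtered p k).comp measurable_fst)
        (measurable_snd.comp measurable_snd)
    have hG2 : Measurable fun x : (Fin k → Obs M) × (Fin 2 × Obs M) =>
        g (Fin.snoc (α := fun _ => Obs M) x.1 x.2.2)
          * ENNReal.ofReal (belief (m.update (m.filtered p k x.1) x.2.2) i) :=
      (hgs.comp (measurable_fst.prodMk (measurable_snd.comp measurable_snd))).mul hb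
    simp only [obsPast_succ, post_succ]
    have e1 := ih.lintegral_step hp hG1
    have e2 := ih.lintegral_step hp hG2
    refine e1.trans (Eq.trans ?_ e2.symm)
    refine lintegral_congr fun ω => ?_
    have hy : Measurable fun y => g (Fin.snoc (α := fun _ => Obs M) (obsPast k ω) y) :=
      hgs.comp measurable_prodMk_left
    have e3 := m.lintegral_mul_belief_update (m.post_mem hp k ω) hy i
    rw [lintegral_obsMix] at e3
    refine Eq.trans ?_ e3.symm
    rw [Finset.sum_eq_single i]
    · simp
    · intro j _ hj
      simp [hj]
    · simp

/-- The law of the next measurement given the past ones. -/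
lemma lintegral_obsPast_meas {p : ℝ} (hp : p ∈ Set.Icc (0 : ℝ) 1) (k : ℕ)
    {H : (Fin k → Obs M) × Obs M → ℝ≥0∞} (hH : Measurable H) :
    ∫⁻ ω, H (obsPast k ω, meas (k + 1) ω) ∂(m.law p)
      = ∫⁻ ω, ∫⁻ y, H (obsPast k ω, y) ∂(m.obsMix (m.post p k ω)) ∂(m.law p) := by
  simp only [lintegral_obsMix]
  exact (m.filterAt hp k).lintegral_step hp
    (hH.comp (measurable_fst.prodMk (measurable_snd.comp measurable_snd)))

lemma measurable_post_obsFiltration (p : ℝ) (k : ℕ) :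
    Measurable[obsFiltration M k] (m.post p k) := by
  rw [obsFiltration_eq_comap]
  exact (m.measurable_filtered p k).comp (comap_measurable _)

lemma cme_ae_eq {p : ℝ} (hp : p ∈ Set.Icc (0 : ℝ) 1) (i : Fin 2) (k : ℕ) :
    m.cme p i k =ᵐ[m.law p] fun ω => belief (m.post p k ω) i := by
  have := m.isProbabilityMeasure_law hp
  have hs : MeasurableSet ({ω | signal k ω = i} : Set (Path M)) :=
    measurable_signal k (measurableSet_singleton i)
  have hb : Measurable[obsFiltration M k] fun ω => belief (m.post p k ω) i :=
    (measurable_belief i).comp (m.measurable_post_obsFiltration p k)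
  have hb' : Measurable fun ω => belief (m.post p k ω) i :=
    (measurable_belief i).comp (m.measurable_post p k)
  have hbn : ∀ ω, 0 ≤ belief (m.post p k ω) i := fun ω => belief_nonneg (m.post_mem hp k ω) i
  have hbi : Integrable (fun ω => belief (m.post p k ω) i) (m.law p) := by
    refine Integrable.of_bound hb'.aestronglyMeasurable 1 (Filter.Eventually.of_forall fun ω => ?_)
    obtain ⟨h0, h1⟩ := m.post_mem hp k ω
    rw [Real.norm_of_nonneg (hbn ω)]
    fin_cases i
    · simpa [belief] using h0
    · simpa [belief] using h1
  refine (ae_eq_condExp_of_forall_setIntegral_eq ((obsFiltration M).le k)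
    ((integrable_const (1 : ℝ)).indicator hs) (fun s _ _ => hbi.integrableOn) (fun s hms _ => ?_)
    hb.stronglyMeasurable.aestronglyMeasurable).symm
  have hms' := hms
  rw [obsFiltration_eq_comap] at hms'
  -- Every observable event is a preimage under `obsPast`, so testing `FilterAt` on indicators
  -- characterizes the conditional expectation.
  obtain ⟨t, ht, rfl⟩ := hms'
  have hst := (obsFiltration M).le k _ hms
  have key := m.filterAt hp k i (t.indicator 1) (measurable_one.indicator ht)
  rw [integral_eq_lintegral_of_nonneg_ae (Filter.Eventually.of_forall hbn)
      hb'.aestronglyMeasurable,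
    integral_eq_lintegral_of_nonneg_ae (Filter.Eventually.of_forall fun ω =>
        Set.indicator_nonneg (fun _ _ => zero_le_one) ω)
      (measurable_const.indicator hs).aestronglyMeasurable,
    ← lintegral_indicator hst, ← lintegral_indicator hst]
  congr 1
  convert key.symm using 1
  · refine lintegral_congr fun ω => ?_
    by_cases h : obsPast k ω ∈ t <;> simp [Set.indicator, h]
  · refine lintegral_congr fun ω => ?_
    by_cases h : obsPast k ω ∈ t <;> by_cases h' : signal k ω = i <;> simp [Set.indicator, h, h']


/-! ### Value iteration and the Bellman equation -/

/-- The expectation of `W` at the updated belief. -/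
def expectNext (W : ℝ → ℝ≥0∞) (p : ℝ) : ℝ≥0∞ := ∫⁻ y, W (m.update p y) ∂(m.obsMix p)

/-- The minimal cost when at most `n` measurements are taken, by backward induction. -/
def valueIter : ℕ → ℝ → ℝ≥0∞
  | 0, p => ENNReal.ofReal (1 - p)
  | n + 1, p => min (ENNReal.ofReal (m.c * p) + m.expectNext (valueIter n) p)
      (ENNReal.ofReal (1 - p))

/-- The limit of the value iteration. -/
def valueLim (p : ℝ) : ℝ≥0∞ := ⨅ n, m.valueIter n p

lemma measurable_expectNext {W : ℝ → ℝ≥0∞} (hW : Measurable W) : Measurable (m.expectNext W) := by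
  have h : m.expectNext W = fun p =>
      ∑ i, ENNReal.ofReal (m.predict p i) * ∫⁻ y, W (m.update p y) ∂(m.obsLaw i) :=
    funext fun p => m.lintegral_obsMix p _
  rw [h]
  exact Finset.measurable_sum _ fun i _ => (m.measurable_predict i).ennreal_ofReal.mul
    (Measurable.lintegral_prod_right' (f := fun x : ℝ × Obs M => W (m.update x.1 x.2))
      (hW.comp m.measurable_update))

lemma measurable_valueIter (n : ℕ) : Measurable (m.valueIter n) := by
  have h1 : Measurable fun p : ℝ => ENNReal.ofReal (1 - p) := by fun_prop
  induction n with
  | zero => exact h1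
  | succ n ih =>
    exact ((measurable_id.const_mul m.c).ennreal_ofReal.add (m.measurable_expectNext ih)).min h1

lemma measurable_valueLim : Measurable m.valueLim :=
  Measurable.iInf m.measurable_valueIter

lemma antitone_valueIter : Antitone m.valueIter := by
  refine antitone_nat_of_succ_le fun n => ?_
  induction n with
  | zero => exact fun p => min_le_right _ _
  | succ n ih =>
    exact fun p => min_le_min_right _ (add_le_add_right (lintegral_mono fun y => ih _) _)

lemma valueLim_le (p : ℝ) : m.valueLim p ≤ ENNReal.ofReal (1 - p) := iInf_le _ 0

lemma valueLim_le_one {p : ℝ} (hp : p ∈ Set.Icc (0 : ℝ) 1) : m.valueLim p ≤ 1 :=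
  (m.valueLim_le p).trans (ENNReal.ofReal_le_one.2 (by linarith [hp.1]))

lemma valueLim_ne_top (p : ℝ) : m.valueLim p ≠ ⊤ :=
  ((m.valueLim_le p).trans_lt ENNReal.ofReal_lt_top).ne

lemma expectNext_one_sub {p : ℝ} (hp : p ∈ Set.Icc (0 : ℝ) 1) :
    m.expectNext (fun q => ENNReal.ofReal (1 - q)) p = ENNReal.ofReal (m.predict p 0) :=
  m.lintegral_belief_update hp 0

lemma expectNext_id {p : ℝ} (hp : p ∈ Set.Icc (0 : ℝ) 1) :
    m.expectNext (fun q => ENNReal.ofReal q) p = ENNReal.ofReal (m.predict p 1) :=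
  m.lintegral_belief_update hp 1

/-- The infimum over `n` passes through the integral by monotone convergence for decreasing
sequences, which needs the integral of the first iterate to be finite (`h0`). -/
lemma valueLim_bellman {p : ℝ} (hp : p ∈ Set.Icc (0 : ℝ) 1) :
    m.valueLim p = min (ENNReal.ofReal (m.c * p) + m.expectNext m.valueLim p)
      (ENNReal.ofReal (1 - p)) := by
  have h0 : ∫⁻ y, m.valueIter 0 (m.update p y) ∂(m.obsMix p) ≠ ⊤ := by
    have e := m.expectNext_one_sub hp
    rw [expectNext] at e
    change ∫⁻ y, ENNReal.ofReal (1 - m.update p y) ∂(m.obsMix p) ≠ ⊤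
    rw [e]
    exact ENNReal.ofReal_ne_top
  have h1 : m.expectNext m.valueLim p = ⨅ n, m.expectNext (m.valueIter n) p :=
    lintegral_iInf (fun n => (m.measurable_valueIter n).comp
      (m.measurable_update_comp measurable_const measurable_id))
      (fun i j hij y => m.antitone_valueIter hij _) h0
  have h2 : m.valueLim p = ⨅ n, m.valueIter (n + 1) p :=
    (Antitone.iInf_nat_add (f := fun n => m.valueIter n p)
      (fun i j hij => m.antitone_valueIter hij p) 1).symm
  rw [h2, h1, ENNReal.add_iInf]
  exact iInf_inf.symm

/-! ### Concavity -/

/-- Concavity on the unit interval of a function with values in `[0, ∞]`. -/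
def ConcaveOnUnit (W : ℝ → ℝ≥0∞) : Prop :=
  ∀ ⦃p⦄, p ∈ Set.Icc (0 : ℝ) 1 → ∀ ⦃q⦄, q ∈ Set.Icc (0 : ℝ) 1 → ∀ ⦃s t : ℝ⦄, 0 ≤ s → 0 ≤ t →
    s + t = 1 → ENNReal.ofReal s * W p + ENNReal.ofReal t * W q ≤ W (s * p + t * q)

lemma convex_comb_mem {p q s t : ℝ} (hp : p ∈ Set.Icc (0 : ℝ) 1) (hq : q ∈ Set.Icc (0 : ℝ) 1)
    (hs : 0 ≤ s) (ht : 0 ≤ t) (hst : s + t = 1) : s * p + t * q ∈ Set.Icc (0 : ℝ) 1 :=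
  convex_Icc (0 : ℝ) 1 hp hq hs ht hst

lemma ofReal_affine_comb {g : ℝ → ℝ} (hg : ∀ p ∈ Set.Icc (0 : ℝ) 1, 0 ≤ g p) {p q s t : ℝ}
    (hp : p ∈ Set.Icc (0 : ℝ) 1) (hq : q ∈ Set.Icc (0 : ℝ) 1) (hs : 0 ≤ s) (ht : 0 ≤ t)
    (h : g (s * p + t * q) = s * g p + t * g q) :
    ENNReal.ofReal s * ENNReal.ofReal (g p) + ENNReal.ofReal t * ENNReal.ofReal (g q)
      = ENNReal.ofReal (g (s * p + t * q)) := by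
  rw [h, ENNReal.ofReal_add (mul_nonneg hs (hg p hp)) (mul_nonneg ht (hg q hq)),
    ENNReal.ofReal_mul hs, ENNReal.ofReal_mul ht]

lemma expectNext_eq_lintegral {W : ℝ → ℝ≥0∞} (hW : Measurable W) {p : ℝ}
    (hp : p ∈ Set.Icc (0 : ℝ) 1) :
    m.expectNext W p
      = ∫⁻ y, ENNReal.ofReal (∑ i, m.unnormalized p y i) * W (m.update p y) := by
  rw [expectNext, m.obsMix_eq_withDensity hp]
  exact lintegral_withDensity_eq_lintegral_mul _ (m.measurable_ofReal_sum_unnormalized p)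
    (hW.comp (m.measurable_update_comp measurable_const measurable_id))

lemma update_mul {p : ℝ} (hp : p ∈ Set.Icc (0 : ℝ) 1) (y : Obs M) :
    m.update p y * ∑ j, m.unnormalized p y j = m.unnormalized p y 1 :=
  m.belief_update_mul hp y 1

/-- Against Lebesgue measure the integrand is a perspective of `W`: the denominator times `W` of
numerator over denominator, both affine in the belief. Perspectives of concave functions are
concave. -/
lemma ConcaveOnUnit.expectNext {W : ℝ → ℝ≥0∞} (hW : Measurable W) (hc : ConcaveOnUnit W) :
    ConcaveOnUnit (m.expectNext W) := by
  intro p hp q hq s t hs ht hst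
  have hr := convex_comb_mem hp hq hs ht hst
  have hmeas : ∀ p, Measurable fun y =>
      ENNReal.ofReal (∑ i, m.unnormalized p y i) * W (m.update p y) := fun p =>
    (m.measurable_ofReal_sum_unnormalized p).mul
      (hW.comp (m.measurable_update_comp measurable_const measurable_id))
  rw [m.expectNext_eq_lintegral hW hp, m.expectNext_eq_lintegral hW hq,
    m.expectNext_eq_lintegral hW hr, ← lintegral_const_mul _ (hmeas p),
    ← lintegral_const_mul _ (hmeas q), ← lintegral_add_left ((hmeas p).const_mul _)]
  refine lintegral_mono fun y => ?_
  have hu : ∀ i, m.unnormalized (s * p + t * q) y i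
      = s * m.unnormalized p y i + t * m.unnormalized q y i := fun i => by
    simp only [unnormalized_apply, m.predict_add s t p q hst]
    ring
  have hsum : ∑ i, m.unnormalized (s * p + t * q) y i
      = s * ∑ i, m.unnormalized p y i + t * ∑ i, m.unnormalized q y i := by
    simp only [hu, Finset.sum_add_distrib, Finset.mul_sum]
  have hup := m.update_mul hp y
  have huq := m.update_mul hq y
  have hur := m.update_mul hr y
  rw [hu 1, hsum] at hur
  have hNp : 0 ≤ ∑ i, m.unnormalized p y i :=
    Finset.sum_nonneg fun i _ => m.unnormalized_nonneg hp y i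
  have hNq : 0 ≤ ∑ i, m.unnormalized q y i :=
    Finset.sum_nonneg fun i _ => m.unnormalized_nonneg hq y i
  rw [hsum, ← mul_assoc, ← mul_assoc, ← ENNReal.ofReal_mul hs, ← ENNReal.ofReal_mul ht]
  generalize (∑ i, m.unnormalized p y i) = Np at *
  generalize (∑ i, m.unnormalized q y i) = Nq at *
  have ha := mul_nonneg hs hNp
  have hb := mul_nonneg ht hNq
  rcases (add_nonneg ha hb).eq_or_lt with h0 | h0
  · have ea : s * Np = 0 := by linarith
    have eb : t * Nq = 0 := by linarith
    simp [ea, eb]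
  -- The posterior of a mixture mixes the posteriors, with weights rescaled by the likelihoods of
  -- `y`.
  · have hupd : m.update (s * p + t * q) y = s * Np / (s * Np + t * Nq) * m.update p y
        + t * Nq / (s * Np + t * Nq) * m.update q y := by
      rw [div_mul_eq_mul_div, div_mul_eq_mul_div, ← add_div, eq_div_iff h0.ne', hur, ← hup, ← huq]
      ring
    have key := hc (m.update_mem hp y) (m.update_mem hq y) (div_nonneg ha h0.le)
      (div_nonneg hb h0.le) (by rw [← add_div, div_self h0.ne'])
    rw [hupd]
    refine le_trans (le_of_eq ?_) (mul_le_mul_right key _)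
    rw [mul_add, ← mul_assoc, ← mul_assoc, ← ENNReal.ofReal_mul h0.le, ← ENNReal.ofReal_mul h0.le,
      mul_div_cancel₀ _ h0.ne', mul_div_cancel₀ _ h0.ne']

lemma concaveOnUnit_valueIter (n : ℕ) : ConcaveOnUnit (m.valueIter n) := by
  have h1 : ConcaveOnUnit fun p => ENNReal.ofReal (1 - p) := by
    intro p hp q hq s t hs ht hst
    refine (ofReal_affine_comb (g := fun p => 1 - p) (fun p hp => by linarith [hp.2])
      hp hq hs ht ?_).le
    linear_combination (-1 : ℝ) * hst
  induction n with
  | zero => exact h1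
  | succ n ih =>
    intro p hp q hq s t hs ht hst
    refine le_min ?_ ?_
    · refine le_trans (add_le_add (mul_le_mul_right (min_le_left _ _) _)
        (mul_le_mul_right (min_le_left _ _) _)) ?_
      rw [mul_add, mul_add, add_add_add_comm]
      refine add_le_add (ofReal_affine_comb (g := fun p => m.c * p)
        (fun p hp => mul_nonneg m.c_pos.le hp.1) hp hq hs ht (by ring)).le ?_
      exact ConcaveOnUnit.expectNext m (m.measurable_valueIter n) ih hp hq hs ht hst
    · exact le_trans (add_le_add (mul_le_mul_right (min_le_right _ _) _)
        (mul_le_mul_right (min_le_right _ _) _)) (h1 hp hq hs ht hst)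

lemma concaveOnUnit_valueLim : ConcaveOnUnit m.valueLim := by
  intro p hp q hq s t hs ht hst
  refine le_iInf fun n => le_trans ?_ (m.concaveOnUnit_valueIter n hp hq hs ht hst)
  exact add_le_add (mul_le_mul_right (iInf_le _ n) _) (mul_le_mul_right (iInf_le _ n) _)

/-! ### The stopping threshold -/

lemma valueLim_zero_of_rho_eq_zero (h : m.rho = 0) : m.valueLim 0 = 1 := by
  have hu : ∀ y, m.update 0 y = 0 := fun y => by
    simp [update, unnormalized_apply, predict_one, h]
  have := m.isProbabilityMeasure_obsMix (p := 0) (by simp)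
  have hn : ∀ n, m.valueIter n 0 = 1 := fun n => by
    induction n with
    | zero => simp [valueIter]
    | succ n ih => simp [valueIter, expectNext, hu, ih]
  simp [valueLim, hn]

lemma valueLim_one : m.valueLim 1 = 0 := by
  simpa using m.valueLim_le 1

/-- The value agrees with the affine function `1 - ·` at `p` and at `1`; concavity puts it above the
chord in between. -/
lemma valueLim_stop_mono {p q : ℝ} (hp : p ∈ Set.Icc (0 : ℝ) 1) (hq : q ∈ Set.Icc (0 : ℝ) 1)
    (hpq : p ≤ q) (h : m.valueLim p = ENNReal.ofReal (1 - p)) :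
    m.valueLim q = ENNReal.ofReal (1 - q) := by
  rcases hp.2.eq_or_lt with rfl | hp1
  · obtain rfl : q = 1 := le_antisymm hq.2 hpq
    exact h
  have hd : 0 < 1 - p := by linarith
  refine le_antisymm (m.valueLim_le q) ?_
  have key := m.concaveOnUnit_valueLim hp (q := 1) (by simp) (s := (1 - q) / (1 - p))
    (t := (q - p) / (1 - p)) (div_nonneg (by linarith [hq.2]) hd.le)
    (div_nonneg (by linarith) hd.le) (by field_simp; ring)
  have e : (1 - q) / (1 - p) * p + (q - p) / (1 - p) * 1 = q := by field_simp; ring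
  rw [e, h, valueLim_one, mul_zero, add_zero, ← ENNReal.ofReal_mul
    (div_nonneg (by linarith [hq.2]) hd.le), div_mul_cancel₀ _ hd.ne'] at key
  exact key

/-- If stopping is optimal at all positive beliefs, then also at belief zero. -/
lemma valueLim_zero_of_forall_pos
    (h : ∀ p ∈ Set.Ioc (0 : ℝ) 1, m.valueLim p = ENNReal.ofReal (1 - p)) : m.valueLim 0 = 1 := by
  rcases m.rho_mem.1.eq_or_lt with hr | hr
  · exact m.valueLim_zero_of_rho_eq_zero hr.symm
  exfalso
  have hc := m.c_pos
  have hd : 0 < 2 * (m.rho + m.c + 1) := by linarith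
  -- Waiting once and then stopping costs `1 - p - ρ + p (ρ + c + 1 - a)`, which beats stopping now
  -- if `p (ρ + c + 1) < ρ`. This `p` makes the left side `ρ / 2`.
  set p := m.rho / (2 * (m.rho + m.c + 1)) with hpd
  have hp0 : 0 < p := div_pos hr hd
  have hpm : p * (m.rho + m.c + 1) = m.rho / 2 := by rw [hpd]; field_simp
  have hp1 : p ≤ 1 := by rw [hpd, div_le_one hd]; linarith
  have hp : p ∈ Set.Icc (0 : ℝ) 1 := ⟨hp0.le, hp1⟩
  have key : ENNReal.ofReal (1 - p) ≤ ENNReal.ofReal (m.c * p + m.predict p 0) := by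
    rw [← h p ⟨hp0, hp1⟩, m.valueLim_bellman hp,
      ENNReal.ofReal_add (mul_nonneg hc.le hp0.le) (m.predict_nonneg hp 0), ← m.expectNext_one_sub hp]
    exact (min_le_left _ _).trans (add_le_add_right (lintegral_mono fun y => m.valueLim_le _) _)
  rw [ENNReal.ofReal_le_ofReal_iff (add_nonneg (mul_nonneg hc.le hp0.le) (m.predict_nonneg hp 0)),
    predict_zero] at key
  have := mul_nonneg m.a_mem.1 hp0.le
  nlinarith

lemma exists_threshold : ∃ h ∈ Set.Icc (0 : ℝ) 1, (m.rho = 0 → h = 0) ∧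
    ∀ p ∈ Set.Icc (0 : ℝ) 1, m.valueLim p = ENNReal.ofReal (1 - p) ↔ h ≤ p := by
  let S : Set ℝ := {p | p ∈ Set.Icc (0 : ℝ) 1 ∧ m.valueLim p = ENNReal.ofReal (1 - p)}
  have h1 : (1 : ℝ) ∈ S := ⟨by simp, by simp [valueLim_one]⟩
  have hb : BddBelow S := ⟨0, fun p hp => hp.1.1⟩
  have h0 : 0 ≤ sInf S := le_csInf ⟨1, h1⟩ fun p hp => hp.1.1
  have hle : sInf S ≤ 1 := csInf_le hb h1
  have hgt : ∀ p ∈ Set.Ioc (sInf S) 1, m.valueLim p = ENNReal.ofReal (1 - p) := by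
    rintro p ⟨hp, hp1⟩
    obtain ⟨q, hq, hqp⟩ := exists_lt_of_csInf_lt ⟨1, h1⟩ hp
    exact m.valueLim_stop_mono hq.1 ⟨h0.trans hp.le, hp1⟩ hqp.le hq.2
  -- A concave function may jump at an endpoint, so infimum `0` is treated separately.
  have hmem : m.valueLim (sInf S) = ENNReal.ofReal (1 - sInf S) := by
    rcases h0.eq_or_lt with e | hpos
    · rw [← e] at hgt ⊢
      rw [m.valueLim_zero_of_forall_pos hgt]
      simp
    by_contra hne
    have hlt := lt_of_le_of_ne (m.valueLim_le _) hne
    have hv := (ENNReal.toReal_lt_of_lt_ofReal hlt)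
    set h := sInf S
    set v := (m.valueLim h).toReal with hvd
    have hv0 : 0 ≤ v := ENNReal.toReal_nonneg
    have hh1 : h < 1 := by linarith
    -- Concavity between `0` and a stopping point `p > h` gives `h (1 - p) ≤ v p`, that is `h ≤ p (v
    -- + h)`. This fails for `p` below `h / (v + h)`, which exceeds `h` because `v < 1 - h`.
    obtain ⟨p, hp1, hp2⟩ := exists_between (a₁ := h) (a₂ := min 1 (h / (v + h)))
      (lt_min hh1 (by rw [lt_div_iff₀ (by linarith)]; nlinarith))
    have hp0 : 0 < p := hpos.trans hp1
    have hpI : p ∈ Set.Icc (0 : ℝ) 1 := ⟨hp0.le, (hp2.trans_le (min_le_left _ _)).le⟩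
    have hp3 := hp2.trans_le (min_le_right _ _)
    rw [lt_div_iff₀ (by linarith)] at hp3
    have key := m.concaveOnUnit_valueLim (p := 0) (by simp) hpI (s := (p - h) / p) (t := h / p)
      (div_nonneg (by linarith) hp0.le) (by positivity) (by field_simp; ring)
    rw [mul_zero, zero_add, div_mul_cancel₀ _ hp0.ne', hgt p ⟨hp1, hpI.2⟩] at key
    have key' : ENNReal.ofReal (h / p * (1 - p)) ≤ m.valueLim h := by
      rw [ENNReal.ofReal_mul (by positivity)]
      exact le_add_self.trans key
    have key2 := (ENNReal.ofReal_le_iff_le_toReal (m.valueLim_ne_top h)).1 key'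
    rw [div_mul_eq_mul_div, div_le_iff₀ hp0] at key2
    nlinarith
  refine ⟨sInf S, ⟨h0, hle⟩, fun hr => le_antisymm (csInf_le hb ⟨by simp, ?_⟩) h0, fun p hp =>
    ⟨fun hp' => csInf_le hb ⟨hp, hp'⟩, fun hp' =>
      m.valueLim_stop_mono ⟨h0, hle⟩ hp hp' hmem⟩⟩
  rw [m.valueLim_zero_of_rho_eq_zero hr]
  simp


end Model

lemma eq_top_or_exists_natCast (t : WithTop ℕ) : t = ⊤ ∨ ∃ k : ℕ, t = (k : WithTop ℕ) := by
  induction t using WithTop.recTopCoe with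
  | top => exact Or.inl rfl
  | coe k => exact Or.inr ⟨k, rfl⟩

lemma untopA_natCast (k : ℕ) : (k : WithTop ℕ).untopA = k := rfl

lemma natCast_succ_le_iff (n : ℕ) (t : WithTop ℕ) :
    ((n + 1 : ℕ) : WithTop ℕ) ≤ t ↔ (n : WithTop ℕ) < t := by
  rcases eq_top_or_exists_natCast t with rfl | ⟨k, rfl⟩
  · simp
  · rw [Nat.cast_le, Nat.cast_lt, Nat.succ_le_iff]

namespace Model

variable {M : ℕ} (m : Model M)

/-! ### Verification along a stopping time -/

open Classical in
/-- The part of the cost of the stopping time `τ` that is incurred at time `l`. -/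
def stageCost (p : ℝ) (τ : Path M → WithTop ℕ) (l : ℕ) (ω : Path M) : ℝ≥0∞ :=
  (if (l : WithTop ℕ) < τ ω then ENNReal.ofReal (m.c * m.post p l ω) else 0)
    + (if τ ω = l then ENNReal.ofReal (1 - m.post p l ω) else 0)

section

variable {τ : Path M → WithTop ℕ}

lemma measurableSet_lt_time (hτ : IsStoppingTime (obsFiltration M) τ) (n : ℕ) :
    MeasurableSet {ω | (n : WithTop ℕ) < τ ω} :=
  (obsFiltration M).le n _ (hτ.measurableSet_gt n)

lemma measurableSet_eq_time (hτ : IsStoppingTime (obsFiltration M) τ) (n : ℕ) :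
    MeasurableSet {ω | τ ω = n} :=
  (obsFiltration M).le n _ (hτ.measurableSet_eq n)

lemma measurableSet_le_time (hτ : IsStoppingTime (obsFiltration M) τ) (n : ℕ) :
    MeasurableSet {ω | (n : WithTop ℕ) ≤ τ ω} :=
  (obsFiltration M).le n _ (hτ.measurableSet_ge n)

open Classical in
lemma measurable_stageCost (hτ : IsStoppingTime (obsFiltration M) τ) (p : ℝ) (l : ℕ) :
    Measurable (m.stageCost p τ l) :=
  (Measurable.ite (measurableSet_lt_time hτ l) ((m.measurable_post p l).const_mul _).ennreal_ofReal
    measurable_const).add (Measurable.ite (measurableSet_eq_time hτ l)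
      ((m.measurable_post p l).const_sub _).ennreal_ofReal measurable_const)

/-- Almost surely `cme` and `post` agree at all times at once. The terminal cost becomes a series
with one term if `τ` is finite and none otherwise. -/
lemma cost_eq_tsum {p : ℝ} (hp : p ∈ Set.Icc (0 : ℝ) 1)
    (hτ : IsStoppingTime (obsFiltration M) τ) :
    m.cost p τ = ∑' l, ∫⁻ ω, m.stageCost p τ l ω ∂(m.law p) := by
  rw [← lintegral_tsum fun l => (m.measurable_stageCost hτ p l).aemeasurable, cost]
  refine lintegral_congr_ae ?_
  filter_upwards [ae_all_iff.2 fun k => m.cme_ae_eq hp 0 k,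
    ae_all_iff.2 fun k => m.cme_ae_eq hp 1 k] with ω h0 h1
  simp only [h0, h1, stageCost, belief, Matrix.cons_val_zero, Matrix.cons_val_one,
    Matrix.cons_val_fin_one]
  rw [ENNReal.tsum_add, ← ENNReal.tsum_mul_left]
  congr 1
  · refine tsum_congr fun l => ?_
    rw [mul_ite, mul_zero, ENNReal.ofReal_mul m.c_pos.le]
  · generalize τ ω = t
    rcases eq_top_or_exists_natCast t with rfl | ⟨k, rfl⟩
    · simp
    · rw [tsum_eq_single k]
      · simp [untopA_natCast]
      · intro l hl
        simp [hl.symm]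

open Classical in
/-- The one-step prediction, restricted to the event that `τ` is still running. -/
lemma lintegral_running_post_succ {p : ℝ} (hp : p ∈ Set.Icc (0 : ℝ) 1)
    (hτ : IsStoppingTime (obsFiltration M) τ) (n : ℕ) {W : ℝ → ℝ≥0∞} (hW : Measurable W) :
    ∫⁻ ω, (if (n : WithTop ℕ) < τ ω then W (m.post p (n + 1) ω) else 0) ∂(m.law p)
      = ∫⁻ ω, (if (n : WithTop ℕ) < τ ω then m.expectNext W (m.post p n ω) else 0) ∂(m.law p) := by
  have hs := hτ.measurableSet_gt n
  rw [obsFiltration_eq_comap] at hs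
  obtain ⟨t, ht, hts⟩ := hs
  -- Whether `τ` is still running after time `n` is decided by the first `n` measurements, so the
  -- event passes through the conditional law of the next one.
  have hiff : ∀ ω, (n : WithTop ℕ) < τ ω ↔ obsPast n ω ∈ t := fun ω => by
    change _ ↔ ω ∈ obsPast n ⁻¹' t
    rw [hts]
    rfl
  have hH : Measurable fun x : (Fin n → Obs M) × Obs M =>
      if x.1 ∈ t then W (m.update (m.filtered p n x.1) x.2) else 0 :=
    Measurable.ite (measurable_fst ht) (hW.comp (m.measurable_update_comp
      ((m.measurable_filtered p n).comp measurable_fst) measurable_snd)) measurable_const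
  simp only [hiff, post_succ]
  refine (m.lintegral_obsPast_meas hp n hH).trans (lintegral_congr fun ω => ?_)
  by_cases h : obsPast n ω ∈ t
  · simp only [h, if_true]
    rfl
  · simp [h]

open Classical in
/-- The part of the value that remains to be paid at time `n`. -/
def remaining (p : ℝ) (τ : Path M → WithTop ℕ) (n : ℕ) : ℝ≥0∞ :=
  ∫⁻ ω, (if (n : WithTop ℕ) ≤ τ ω then m.valueLim (m.post p n ω) else 0) ∂(m.law p)

lemma remaining_zero {p : ℝ} (hp : p ∈ Set.Icc (0 : ℝ) 1) : m.remaining p τ 0 = m.valueLim p := by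
  have := m.isProbabilityMeasure_law hp
  simp [remaining, post_zero]

open Classical in
-- Since `n + 1 ≤ τ` means `n < τ`, the prediction step pulls the next remaining value back to time
-- `n`, exposing the two branches of the Bellman minimum.
lemma stage_add_remaining {p : ℝ} (hp : p ∈ Set.Icc (0 : ℝ) 1)
    (hτ : IsStoppingTime (obsFiltration M) τ) (n : ℕ) :
    ∫⁻ ω, m.stageCost p τ n ω ∂(m.law p) + m.remaining p τ (n + 1)
      = ∫⁻ ω, ((if (n : WithTop ℕ) < τ ω then ENNReal.ofReal (m.c * m.post p n ω)
          + m.expectNext m.valueLim (m.post p n ω) else 0)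
        + (if τ ω = n then ENNReal.ofReal (1 - m.post p n ω) else 0)) ∂(m.law p) := by
  simp only [remaining, natCast_succ_le_iff]
  rw [m.lintegral_running_post_succ hp hτ n m.measurable_valueLim,
    ← lintegral_add_left (m.measurable_stageCost hτ p n)]
  refine lintegral_congr fun ω => ?_
  rw [stageCost, add_right_comm]
  congr 1
  split_ifs <;> simp

lemma remaining_le {p : ℝ} (hp : p ∈ Set.Icc (0 : ℝ) 1)
    (hτ : IsStoppingTime (obsFiltration M) τ) (n : ℕ) :
    m.remaining p τ n ≤ ∫⁻ ω, m.stageCost p τ n ω ∂(m.law p) + m.remaining p τ (n + 1) := by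
  rw [m.stage_add_remaining hp hτ n]
  refine lintegral_mono fun ω => ?_
  have hb := m.valueLim_bellman (m.post_mem hp n ω)
  rcases lt_trichotomy (n : WithTop ℕ) (τ ω) with h | h | h
  · rw [if_pos h.le, if_pos h, if_neg h.ne', add_zero, hb]
    exact min_le_left _ _
  · rw [if_pos h.le, if_neg h.not_lt, if_pos h.symm, zero_add]
    exact m.valueLim_le _
  · rw [if_neg h.not_ge]
    exact zero_le

/-- The rule `τ` continues and stops as the Bellman recursion prescribes. -/
def Prescribed (p : ℝ) (τ : Path M → WithTop ℕ) : Prop :=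
  ∀ᵐ ω ∂(m.law p), ∀ n : ℕ,
    ((n : WithTop ℕ) < τ ω → m.valueLim (m.post p n ω) ≠ ENNReal.ofReal (1 - m.post p n ω)) ∧
    (τ ω = n → m.valueLim (m.post p n ω) = ENNReal.ofReal (1 - m.post p n ω))

lemma remaining_eq {p : ℝ} (hp : p ∈ Set.Icc (0 : ℝ) 1)
    (hτ : IsStoppingTime (obsFiltration M) τ) (h : m.Prescribed p τ) (n : ℕ) :
    m.remaining p τ n = ∫⁻ ω, m.stageCost p τ n ω ∂(m.law p) + m.remaining p τ (n + 1) := by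
  rw [m.stage_add_remaining hp hτ n]
  refine lintegral_congr_ae ?_
  filter_upwards [h] with ω hω
  obtain ⟨h1, h2⟩ := hω n
  have hb := m.valueLim_bellman (m.post_mem hp n ω)
  rcases lt_trichotomy (n : WithTop ℕ) (τ ω) with h | h | h
  · rw [if_pos h.le, if_pos h, if_neg h.ne', add_zero]
    rcases min_choice (ENNReal.ofReal (m.c * m.post p n ω)
      + m.expectNext m.valueLim (m.post p n ω)) (ENNReal.ofReal (1 - m.post p n ω)) with e | e
    · rw [hb, e]
    · exact absurd (hb.trans e) (h1 h)
  · rw [if_pos h.le, if_neg h.not_lt, if_pos h.symm, zero_add, h2 h.symm]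
  · rw [if_neg h.not_ge, if_neg h.not_gt, if_neg h.ne, add_zero]

/-- Iterating `remaining_le` leaves an error of at most the probability of `n ≤ τ`, as `valueLim ≤
1`; it vanishes in the limit because `τ` is almost surely finite. -/
lemma valueLim_le_cost {p : ℝ} (hp : p ∈ Set.Icc (0 : ℝ) 1) (hτ : m.IsStoppingRule p τ) :
    m.valueLim p ≤ m.cost p τ := by
  have := m.isProbabilityMeasure_law hp
  have hpart : ∀ n, m.valueLim p
      ≤ ∑ l ∈ Finset.range n, ∫⁻ ω, m.stageCost p τ l ω ∂(m.law p) + m.remaining p τ n := by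
    intro n
    induction n with
    | zero => simp [m.remaining_zero hp]
    | succ n ih =>
      rw [Finset.sum_range_succ, add_assoc]
      exact ih.trans (add_le_add_right (m.remaining_le hp hτ.1 n) _)
  have hrem : ∀ n, m.remaining p τ n ≤ m.law p {ω | (n : WithTop ℕ) ≤ τ ω} := by
    intro n
    rw [← lintegral_indicator_one (measurableSet_le_time hτ.1 n)]
    refine lintegral_mono fun ω => ?_
    by_cases h : (n : WithTop ℕ) ≤ τ ω
    · simpa [h] using m.valueLim_le_one (m.post_mem hp n ω)
    · simp [h]
  have hlim : Filter.Tendsto (fun n : ℕ => m.law p {ω | (n : WithTop ℕ) ≤ τ ω}) Filter.atTop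
      (nhds 0) := by
    have h0 : m.law p (⋂ n : ℕ, {ω | (n : WithTop ℕ) ≤ τ ω}) = 0 := by
      refine measure_mono_null (fun ω hω => ?_) (ae_iff.1 hτ.2)
      simp only [Set.mem_iInter, Set.mem_ofPred_eq] at hω
      simp only [Set.mem_ofPred_eq, not_not]
      by_contra hne
      obtain ⟨k, hk⟩ := (eq_top_or_exists_natCast _).resolve_left hne
      have := (natCast_succ_le_iff k _).1 (hω (k + 1))
      rw [hk] at this
      exact lt_irrefl _ this
    rw [← h0]
    refine tendsto_measure_iInter_atTop
      (fun n => (measurableSet_le_time hτ.1 n).nullMeasurableSet) (fun i j hij ω hω => ?_)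
      ⟨0, measure_ne_top _ _⟩
    have hij' : (i : WithTop ℕ) ≤ j := by exact_mod_cast hij
    exact hij'.trans hω
  have hlim' := hlim.const_add (m.cost p τ)
  rw [add_zero] at hlim'
  refine ge_of_tendsto' hlim' fun n => (hpart n).trans (add_le_add ?_ (hrem n))
  rw [m.cost_eq_tsum hp hτ.1]
  exact ENNReal.sum_le_tsum _

/-- The remaining value is nonnegative and can be dropped, so finiteness of `τ` is not required.
This allows finiteness of the threshold rule to be deduced afterwards. -/
lemma cost_le_valueLim {p : ℝ} (hp : p ∈ Set.Icc (0 : ℝ) 1)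
    (hτ : IsStoppingTime (obsFiltration M) τ) (h : m.Prescribed p τ) :
    m.cost p τ ≤ m.valueLim p := by
  rw [m.cost_eq_tsum hp hτ, ENNReal.tsum_eq_iSup_nat]
  refine iSup_le fun n => ?_
  have hpart : m.valueLim p
      = ∑ l ∈ Finset.range n, ∫⁻ ω, m.stageCost p τ l ω ∂(m.law p) + m.remaining p τ n := by
    induction n with
    | zero => simp [m.remaining_zero hp]
    | succ n ih => rw [Finset.sum_range_succ, add_assoc, ← m.remaining_eq hp hτ h n, ← ih]
  rw [hpart]
  exact le_self_add

open Classical in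
/-- If `e₂` can be reached from `e₁`, a stopping time of finite cost is almost surely finite. -/
lemma ae_ne_top_of_cost_ne_top {p : ℝ} (hp : p ∈ Set.Icc (0 : ℝ) 1) (hr : 0 < m.rho)
    (hτ : IsStoppingTime (obsFiltration M) τ) (hc : m.cost p τ ≠ ⊤) :
    ∀ᵐ ω ∂(m.law p), τ ω ≠ ⊤ := by
  have := m.isProbabilityMeasure_law hp
  let u : ℕ → ℝ≥0∞ := fun k =>
    ∫⁻ ω, (if (k : WithTop ℕ) < τ ω then ENNReal.ofReal (m.post p k ω) else 0) ∂(m.law p)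
  let v : ℕ → ℝ≥0∞ := fun k => m.law p {ω | τ ω = k}
  have hmu : ∀ k : ℕ, Measurable fun ω =>
      if (k : WithTop ℕ) < τ ω then ENNReal.ofReal (m.post p k ω) else 0 := fun k =>
    Measurable.ite (measurableSet_lt_time hτ k) (m.measurable_post p k).ennreal_ofReal
      measurable_const
  have hu : ∑' k, u k ≠ ⊤ := by
    intro htop
    refine hc (top_le_iff.1 ?_)
    rw [m.cost_eq_tsum hp hτ]
    calc (⊤ : ℝ≥0∞) = ∑' k, ENNReal.ofReal m.c * u k := by
          rw [ENNReal.tsum_mul_left, htop, ENNReal.mul_top (by simpa using m.c_pos)]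
      _ ≤ _ := by
          refine ENNReal.tsum_le_tsum fun k => ?_
          rw [← lintegral_const_mul _ (hmu k)]
          refine lintegral_mono fun ω => le_trans (le_of_eq ?_) le_self_add
          rw [mul_ite, mul_zero, ENNReal.ofReal_mul m.c_pos.le]
  have hv : ∑' k, v k ≠ ⊤ := by
    rw [← measure_iUnion (fun i j hij => ?_) fun k => measurableSet_eq_time hτ k]
    · exact measure_ne_top _ _
    · refine Set.disjoint_left.2 fun ω (h1 : τ ω = i) (h2 : τ ω = j) => hij ?_
      exact_mod_cast h1.symm.trans h2
  have hshift : ∀ w : ℕ → ℝ≥0∞, ∑' k, w (k + 1) ≤ ∑' k, w k := fun w =>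
    ENNReal.tsum_comp_le_tsum_of_injective (add_left_injective 1) w
  -- If `τ = ⊤` and the belief is `b`, then `b` plus the predicted belief is `b + ρ (1 - b) + a b ≥
  -- ρ`. Summed over `k`, the constant left side diverges unless `τ = ⊤` is a null event, while the
  -- right side is summable.
  have hstep : ∀ k,
      ENNReal.ofReal m.rho * m.law p {ω | τ ω = ⊤} ≤ u k + (u (k + 1) + v (k + 1)) := by
    intro k
    have htop : MeasurableSet {ω | τ ω = ⊤} := by
      have : {ω | τ ω = ⊤} = (⋃ n : ℕ, {ω | τ ω = n})ᶜ := by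
        ext ω
        simp only [Set.mem_ofPred_eq, Set.mem_compl_iff, Set.mem_iUnion]
        rcases eq_top_or_exists_natCast (τ ω) with e | ⟨k, e⟩ <;> simp [e]
      rw [this]
      exact (MeasurableSet.iUnion fun n => measurableSet_eq_time hτ n).compl
    have h1 : ∫⁻ ω, (if (k : WithTop ℕ) < τ ω then ENNReal.ofReal (m.post p (k + 1) ω) else 0)
        ∂(m.law p) ≤ u (k + 1) + v (k + 1) := by
      have e := lintegral_indicator_one (μ := m.law p) (measurableSet_eq_time hτ (k + 1))
      rw [show v (k + 1) = _ from e.symm, ← lintegral_add_left (hmu (k + 1))]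
      refine lintegral_mono fun ω => ?_
      by_cases h : (k : WithTop ℕ) < τ ω
      · rcases ((natCast_succ_le_iff k _).2 h).eq_or_lt with h' | h'
        -- Stopping exactly at `k + 1` is not counted in `u (k + 1)`; there the belief is at most
        -- `1`, which `v (k + 1)` covers.
        · rw [if_pos h, if_neg h'.not_lt, Set.indicator_of_mem (Set.mem_ofPred_eq ▸ h'.symm),
            zero_add]
          exact ENNReal.ofReal_le_one.2 (m.post_mem hp (k + 1) ω).2
        · rw [if_pos h, if_pos h']
          exact le_self_add
      · simp [h]
    refine le_trans ?_ (add_le_add_right h1 _)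
    rw [m.lintegral_running_post_succ hp hτ k (W := fun q => ENNReal.ofReal q) (by fun_prop),
      ← lintegral_add_left (hmu k), ← lintegral_indicator_one htop,
      ← lintegral_const_mul _ (measurable_one.indicator htop)]
    refine lintegral_mono fun ω => ?_
    by_cases h : τ ω = ⊤
    · have hpost := m.post_mem hp k ω
      simp only [Set.indicator, Set.mem_ofPred_eq, h, if_true, Pi.one_apply,
        mul_one, WithTop.natCast_lt_top]
      rw [m.expectNext_id hpost, ← ENNReal.ofReal_add hpost.1 (m.predict_nonneg hpost 1)]
      refine ENNReal.ofReal_le_ofReal ?_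
      rw [predict_one]
      have h1 := mul_nonneg m.a_mem.1 hpost.1
      have h2 := mul_le_of_le_one_left hpost.1 m.rho_mem.2
      linarith
    · simp [h]
  have hsum := ENNReal.tsum_le_tsum hstep
  rw [ENNReal.tsum_add, ENNReal.tsum_add] at hsum
  have hfin : ∑' k, u k + (∑' k, u (k + 1) + ∑' k, v (k + 1)) ≠ ⊤ :=
    ENNReal.add_ne_top.2 ⟨hu, ENNReal.add_ne_top.2
      ⟨ne_top_of_le_ne_top hu (hshift u), ne_top_of_le_ne_top hv (hshift v)⟩⟩
  rw [ae_iff]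
  simp only [ne_eq, not_not]
  by_contra hne
  refine hfin (top_le_iff.1 (le_trans (le_of_eq ?_) hsum))
  rw [ENNReal.tsum_const_eq_top_of_ne_zero]
  exact mul_ne_zero (by simpa using hr) hne

end

/-! ### Optimality of the threshold rule and transfer to the value function -/

lemma isStoppingTime_thresholdRule (p h : ℝ) :
    IsStoppingTime (obsFiltration M) (m.thresholdRule p h) := by
  refine Adapted.isStoppingTime_hittingAfter (fun k => ?_) measurableSet_Ici
  exact stronglyMeasurable_condExp.measurable

lemma prescribed_thresholdRule {p h : ℝ} (hp : p ∈ Set.Icc (0 : ℝ) 1)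
    (hh : ∀ q ∈ Set.Icc (0 : ℝ) 1, m.valueLim q = ENNReal.ofReal (1 - q) ↔ h ≤ q) :
    m.Prescribed p (m.thresholdRule p h) := by
  filter_upwards [ae_all_iff.2 fun k => m.cme_ae_eq hp 1 k] with ω hω n
  have e : m.cme p 1 n ω = m.post p n ω := hω n
  rw [Ne, hh _ (m.post_mem hp n ω), ← e]
  refine ⟨fun hn => notMem_of_lt_hittingAfter (k := n) hn (Nat.zero_le n), fun hn => ?_⟩
  have hmem := hittingAfter_mem_set_of_ne_top (u := m.cme p 1) (s := Set.Ici h) (n := 0) (ω := ω)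
    (by change m.thresholdRule p h ω ≠ ⊤; rw [hn]; exact WithTop.coe_ne_top)
  change m.cme p 1 (m.thresholdRule p h ω).untopA ω ∈ Set.Ici h at hmem
  rw [hn] at hmem
  rwa [untopA_natCast] at hmem

/-- If `ρ = 0`, the threshold `0` is met at time `0`. Otherwise the cost is at most `valueLim`,
hence finite, which forces almost sure stopping. -/
lemma isStoppingRule_thresholdRule {p h : ℝ} (hp : p ∈ Set.Icc (0 : ℝ) 1)
    (h0 : m.rho = 0 → h = 0)
    (hh : ∀ q ∈ Set.Icc (0 : ℝ) 1, m.valueLim q = ENNReal.ofReal (1 - q) ↔ h ≤ q) :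
    m.IsStoppingRule p (m.thresholdRule p h) := by
  refine ⟨m.isStoppingTime_thresholdRule p h, ?_⟩
  rcases m.rho_mem.1.eq_or_lt with hr | hr
  · filter_upwards [m.cme_ae_eq hp 1 0] with ω hω
    have hle : m.thresholdRule p h ω ≤ (0 : ℕ) := hittingAfter_le_of_mem (i := 0) le_rfl (by
      rw [Set.mem_Ici, hω, h0 hr.symm]
      exact hp.1)
    exact ne_top_of_le_ne_top WithTop.coe_ne_top hle
  · exact m.ae_ne_top_of_cost_ne_top hp hr (m.isStoppingTime_thresholdRule p h)
      (ne_top_of_le_ne_top (m.valueLim_ne_top p) (m.cost_le_valueLim hp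
        (m.isStoppingTime_thresholdRule p h) (m.prescribed_thresholdRule hp hh)))

lemma value_eq {p : ℝ} (hp : p ∈ Set.Icc (0 : ℝ) 1) : m.value p = (m.valueLim p).toReal := by
  obtain ⟨h, -, h0, hh⟩ := m.exists_threshold
  rw [value]
  congr 1
  refine le_antisymm ?_ (le_iInf fun τ => m.valueLim_le_cost hp τ.2)
  exact iInf_le_of_le ⟨_, m.isStoppingRule_thresholdRule hp h0 hh⟩ (m.cost_le_valueLim hp
    (m.isStoppingTime_thresholdRule p h) (m.prescribed_thresholdRule hp hh))

lemma value_eq_stop_iff {p : ℝ} (hp : p ∈ Set.Icc (0 : ℝ) 1) :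
    m.value p = 1 - p ↔ m.valueLim p = ENNReal.ofReal (1 - p) := by
  rw [m.value_eq hp, ← ENNReal.toReal_eq_toReal_iff' (m.valueLim_ne_top p) ENNReal.ofReal_ne_top,
    ENNReal.toReal_ofReal (by linarith [hp.2])]

lemma concaveOn_value : ConcaveOn ℝ (Set.Icc (0 : ℝ) 1) m.value := by
  refine ⟨convex_Icc _ _, fun p hp q hq s t hs ht hst => ?_⟩
  have hr := convex_comb_mem hp hq hs ht hst
  simp only [smul_eq_mul]
  rw [m.value_eq hp, m.value_eq hq, m.value_eq hr]
  have h := ENNReal.toReal_mono (m.valueLim_ne_top _) (m.concaveOnUnit_valueLim hp hq hs ht hst)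
  rwa [ENNReal.toReal_add (ENNReal.mul_ne_top ENNReal.ofReal_ne_top (m.valueLim_ne_top _))
    (ENNReal.mul_ne_top ENNReal.ofReal_ne_top (m.valueLim_ne_top _)), ENNReal.toReal_mul,
    ENNReal.toReal_mul, ENNReal.toReal_ofReal hs, ENNReal.toReal_ofReal ht] at h

lemma lintegral_valueLim_update {p : ℝ} (hp : p ∈ Set.Icc (0 : ℝ) 1) :
    ∫⁻ ω, m.valueLim (m.update p (meas 1 ω)) ∂(m.law p) = m.expectNext m.valueLim p := by
  have := m.isProbabilityMeasure_law hp
  have h := m.lintegral_obsPast_meas hp 0 (H := fun x => m.valueLim (m.update p x.2))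
    (m.measurable_valueLim.comp (m.measurable_update_comp measurable_const measurable_snd))
  simpa [post_zero] using! h

lemma expectNext_valueLim_ne_top {p : ℝ} (hp : p ∈ Set.Icc (0 : ℝ) 1) :
    m.expectNext m.valueLim p ≠ ⊤ := by
  have h : m.expectNext m.valueLim p ≤ ENNReal.ofReal (m.predict p 0) := by
    rw [← m.expectNext_one_sub hp]
    exact lintegral_mono fun y => m.valueLim_le _
  exact ne_top_of_le_ne_top ENNReal.ofReal_ne_top h

lemma value_bellman {p : ℝ} (hp : p ∈ Set.Icc (0 : ℝ) 1) :
    Integrable (fun ω => m.value (m.update p (meas 1 ω))) (m.law p) ∧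
      m.value p = min (m.c * p + ∫ ω, m.value (m.update p (meas 1 ω)) ∂(m.law p)) (1 - p) := by
  have e : (fun ω : Path M => m.value (m.update p (meas 1 ω)))
      = fun ω => (m.valueLim (m.update p (meas 1 ω))).toReal :=
    funext fun ω => m.value_eq (m.update_mem hp _)
  have hmeas : Measurable fun ω : Path M => m.valueLim (m.update p (meas 1 ω)) :=
    m.measurable_valueLim.comp (m.measurable_update_comp measurable_const (measurable_meas 1))
  have hfin := m.expectNext_valueLim_ne_top hp
  have hi : ∫⁻ ω, m.valueLim (m.update p (meas 1 ω)) ∂(m.law p) ≠ ⊤ := by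
    rwa [m.lintegral_valueLim_update hp]
  rw [e]
  refine ⟨integrable_toReal_of_lintegral_ne_top hmeas.aemeasurable hi, ?_⟩
  rw [integral_toReal hmeas.aemeasurable (Filter.Eventually.of_forall fun ω =>
    (m.valueLim_ne_top _).lt_top), m.lintegral_valueLim_update hp, m.value_eq hp,
    m.valueLim_bellman hp, ENNReal.toReal_min
      (ENNReal.add_ne_top.2 ⟨ENNReal.ofReal_ne_top, hfin⟩) ENNReal.ofReal_ne_top,
    ENNReal.toReal_add ENNReal.ofReal_ne_top hfin,
    ENNReal.toReal_ofReal (mul_nonneg m.c_pos.le hp.1),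
    ENNReal.toReal_ofReal (by linarith [hp.2])]

end Model

end ISD

end

theorem mainTheorem1 {M : ℕ} (m : ISD.Model M) :
    -- the value function is concave and satisfies the Bellman recursion
    ConcaveOn ℝ (Set.Icc (0 : ℝ) 1) m.value ∧
    (∀ p ∈ Set.Icc (0 : ℝ) 1,
      Integrable (fun ω => m.value (m.update p (ISD.meas 1 ω))) (m.law p) ∧
      m.value p = min (m.c * p + ∫ ω, m.value (m.update p (ISD.meas 1 ω)) ∂(m.law p)) (1 - p)) ∧
    ∃ h ∈ Set.Icc (0 : ℝ) 1,
      -- the stopping set is an interval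
      {p | p ∈ Set.Icc (0 : ℝ) 1 ∧ m.value p = 1 - p} = Set.Icc h 1 ∧
      ∀ p ∈ Set.Icc (0 : ℝ) 1,
        -- the rule with threshold `h` is optimal
        m.IsOptimal p (m.thresholdRule p h) ∧
        -- also among the stopping times that need not be finite, if `ρ > 0`
        (0 < m.rho → ∀ τ, IsStoppingTime (ISD.obsFiltration M) τ →
          m.cost p (m.thresholdRule p h) ≤ m.cost p τ) := by
  obtain ⟨h, hI, h0, hh⟩ := m.exists_threshold
  refine ⟨m.concaveOn_value, fun p hp => m.value_bellman hp, h, hI, ?_, fun p hp => ?_⟩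
  · ext p
    constructor
    · rintro ⟨hp, hv⟩
      exact ⟨(hh p hp).1 ((m.value_eq_stop_iff hp).1 hv), hp.2⟩
    · rintro ⟨h1, h2⟩
      have hp : p ∈ Set.Icc (0 : ℝ) 1 := ⟨hI.1.trans h1, h2⟩
      exact ⟨hp, (m.value_eq_stop_iff hp).2 ((hh p hp).2 h1)⟩
  · have hle := m.cost_le_valueLim hp (m.isStoppingTime_thresholdRule p h)
      (m.prescribed_thresholdRule hp hh)
    refine ⟨⟨m.isStoppingRule_thresholdRule hp h0 hh, fun σ hσ =>
      hle.trans (m.valueLim_le_cost hp hσ)⟩, fun hr τ hτ => ?_⟩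
    -- A stopping time of finite cost is already a stopping rule when `ρ > 0`.
    by_cases hc : m.cost p τ = ⊤
    · rw [hc]
      exact le_top
    · exact hle.trans (m.valueLim_le_cost hp ⟨hτ, m.ae_ne_top_of_cost_ne_top hp hr hτ hc⟩)
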